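/- Let $M\ge 3$ and $r$ be integers with $0<r\le M/2$, and put $k=\lfloor M/2\rfloor$. For $n\ge 0$, a $t$-color partition of $n$ is a pair $(\alpha,c)$, where $\alpha=(\alpha_1\ge\alpha_2\ge\dots\ge\alpha_l)$ is a partition of $n$ into positive integers (the empty partition if $n=0$) and $c$ assigns to each $i\in\{1,\dots,l\}$ a color $c(i)\in\{1,\dots,t\}$ such that $c(i)\le c(i+1)$ whenever $\alpha_i=\alpha_{i+1}$. Let $C_n(M,r)$ be the set of $(k-1)$-color partitions $(\alpha,c)$ of $n$ that satisfy the following three conditions. (i) For $1\le i\le l$: $\alpha_i>|2c(i)-r+1|$ if $\alpha_i\equiv r\pmod 2$, and $\alpha_i>|2c(i)-r|$ otherwise. (ii) For $1\le i<l$: $$\alpha_i-\alpha_{i+1}\ \ge\ \begin{cases}2+|2(c(i)-c(i+1))| & \text{if }\alpha_i\equiv\alpha_{i+1}\pmod 2,\\ 2+|2(c(i)-c(i+1))-1| & \text{if }\alpha_i\not\equiv\alpha_{i+1}\text{ and }\alpha_{i+1}\equiv r\pmod 2,\\ 2+|2(c(i)-c(i+1))+1| & \text{if }\alpha_{i+1}\not\equiv\alpha_i\text{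 and }\alpha_i\equiv r\pmod 2.\end{cases}$$ (iii) If $M$ is even, then $\alpha_i\not\equiv r\pmod 2$ for every $i$ with $c(i)=k-1$. Then, with $(q)_\infty=\prod_{n\ge1}(1-q^n)$, the following identity of formal power series in $q$ holds, with all infinite sums and products convergent: $$\sum_{n=0}^{\infty}|C_n(M,r)|\,q^n=\frac{1}{(q)_\infty}\sum_{j=-\infty}^{\infty}(-1)^jq^{j(Mj+M-2r)/2}.$$ If moreover $r<M/2$, then $$\frac{1}{(q)_\infty}\sum_{j=-\infty}^{\infty}(-1)^jq^{j(Mj+M-2r)/2}=\prod_{\substack{n\ge1\\ n\not\equiv0,\pm r\ (\mathrm{mod}\ M)}}(1-q^n)^{-1},$$ where the product is convergent too. -/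

import Mathlib

open PowerSeries
open scoped PowerSeries.WithPiTopology

/-- A `t`-color partition `(α, c)` of `n`.  The entry with (zero-based) position `i` of the list
`parts` is the pair `(α_{i+1}, c(i+1))` formed by a part and its color. For `n = 0` there is only
the empty one. -/
structure ColorPartition (t n : ℕ) where
  parts : List (ℕ × ℕ)
  part_pos : ∀ p ∈ parts, 0 < p.1
  color_mem : ∀ p ∈ parts, 1 ≤ p.2 ∧ p.2 ≤ t
  sorted : parts.IsChain (fun p p' => p'.1 ≤ p.1 ∧ (p.1 = p'.1 → p.2 ≤ p'.2))
  sum_parts : (parts.map Prod.fst).sum = n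

/-- A part of size `a` and color `c` has to be larger than this number. -/
def initialBound (r a c : ℕ) : ℤ :=
  if a ≡ r [MOD 2] then |2 * (c : ℤ) - r + 1| else |2 * (c : ℤ) - r|

/-- The least allowed difference between a part of size `a` and color `c` and the next part, of
size `a'` and color `c'`. In the last case `a ≡ r` and `a' ≢ r` modulo 2. -/
def gapBound (r a c a' c' : ℕ) : ℤ :=
  if a ≡ a' [MOD 2] then 2 + |2 * ((c : ℤ) - c')|
  else if a' ≡ r [MOD 2] then 2 + |2 * ((c : ℤ) - c') - 1|
  else 2 + |2 * ((c : ℤ) - c') + 1|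

/-- The set `C_n(M, r)` of `(k - 1)`-color partitions of `n`, where `k = ⌊M / 2⌋`. -/
def colorSet (M r n : ℕ) : Set (ColorPartition (M / 2 - 1) n) :=
  {α | (∀ p ∈ α.parts, initialBound r p.1 p.2 < (p.1 : ℤ)) ∧
    α.parts.IsChain (fun p p' => gapBound r p.1 p.2 p'.1 p'.2 ≤ (p.1 : ℤ) - (p'.1 : ℤ)) ∧
    (Even M → ∀ p ∈ α.parts, p.2 = M / 2 - 1 → ¬ p.1 ≡ r [MOD 2])}

/-- The exponent `j (M j + M - 2 r) / 2`. -/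
def thetaExponent (M r : ℕ) (j : ℤ) : ℕ :=
  (j * ((M : ℤ) * j + M - 2 * r) / 2).toNat

/-- The division by 2 is exact and the exponent is nonnegative. -/
theorem two_mul_thetaExponent (M r : ℕ) (hrM : 2 * r ≤ M) (j : ℤ) :
    2 * (thetaExponent M r j : ℤ) = j * ((M : ℤ) * j + M - 2 * r) := by
  have hnn : 0 ≤ j * ((M : ℤ) * j + M - 2 * r) := by
    have h : (2 * r : ℤ) ≤ M := by exact_mod_cast hrM
    have hM : (0 : ℤ) ≤ M := by positivity
    have hr : (0 : ℤ) ≤ r := by positivity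
    rcases le_or_gt 0 j with hj | hj
    · exact mul_nonneg hj (by nlinarith [mul_nonneg hM hj])
    · exact mul_nonneg_of_nonpos_of_nonpos hj.le (by nlinarith [mul_nonneg hM (by omega : 0 ≤ -1 - j)])
  have hdvd : (2 : ℤ) ∣ j * ((M : ℤ) * j + M - 2 * r) := by
    have h := (Int.even_mul_succ_self j).two_dvd
    have e : j * ((M : ℤ) * j + M - 2 * r) = M * (j * (j + 1)) - 2 * (r * j) := by ring
    rw [e]
    exact dvd_sub (h.mul_left _) (dvd_mul_right _ _)
  unfold thetaExponent
  rw [Int.toNat_of_nonneg (by omega)]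
  omega

/-- So the cardinality of `colorSet M r n` is its true number of elements. -/
theorem colorPartition_finite (t n : ℕ) : Finite (ColorPartition t n) := by
  have hlen : ∀ α : ColorPartition t n, α.parts.length ≤ n := by
    intro α
    have h := List.card_nsmul_le_sum (α.parts.map Prod.fst) 1 (by
      intro a ha
      obtain ⟨p, hp, rfl⟩ := List.mem_map.1 ha
      exact α.part_pos p hp)
    simpa [α.sum_parts] using h
  have hle : ∀ α : ColorPartition t n, ∀ p ∈ α.parts, p.1 ≤ n := by
    intro α p hp
    have h := List.single_le_sum (l := α.parts.map Prod.fst) (by simp) p.1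
      (List.mem_map_of_mem hp)
    rwa [α.sum_parts] at h
  have hfin := List.finite_length_le (Fin (n + 1) × Fin (t + 1)) n
  refine Set.Finite.to_subtype (s := Set.univ) ?_ |> fun h => (Equiv.Set.univ _).finite_iff.1 h
  refine Set.Finite.of_finite_image (f := ColorPartition.parts)
    ((hfin.image (List.map (fun p => ((p.1 : ℕ), (p.2 : ℕ))))).subset ?_) ?_
  · rintro _ ⟨α, -, rfl⟩
    refine ⟨α.parts.map (fun p => (Fin.ofNat (n + 1) p.1, Fin.ofNat (t + 1) p.2)), ?_, ?_⟩
    · simpa using hlen α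
    · rw [List.map_map]
      refine (List.map_congr_left ?_).trans (List.map_id _)
      intro p hp
      have h1 := hle α p hp
      have h2 := (α.color_mem p hp).2
      ext <;> simp [Nat.mod_eq_of_lt, h1, h2]
  · rintro ⟨a, _, _, _, _⟩ - ⟨b, _, _, _, _⟩ - h
    simpa using h

/-- The generating function `∑_{n ≥ 0} |C_n(M, r)| q ^ n`. -/
noncomputable def colorGenFun (M r : ℕ) : ℚ⟦X⟧ :=
  PowerSeries.mk fun n => ((colorSet M r n).ncard : ℚ)

/-- The positive integers `n` with `n ≢ 0, r, -r (mod M)`. -/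
def allowedParts (M r : ℕ) : Set ℕ :=
  {n | 0 < n ∧ ¬ (n : ℤ) ≡ 0 [ZMOD M] ∧ ¬ (n : ℤ) ≡ r [ZMOD M] ∧ ¬ (n : ℤ) ≡ -r [ZMOD M]}

/-! The coloring encodes successive ranks. A part of size `s` and color `c` corresponds to a
Frobenius column `(a, b)` with `a + b + 1 = s` and rank `a - b` equal to `2c - r + 1` if `s ≡ r` mod
2 and to `2c - r` otherwise. Condition (i) becomes `s > |a - b|`, i.e. `a, b ≥ 0`; condition (ii)
becomes strict decrease of both rows; the range of colors with (iii) becomes `2 - r ≤ a - b ≤ M - r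
- 2` (`ncard_colorSet`).

Symbols with such ranks are then counted inside a box. Inclusion-exclusion on the first column gives
a recurrence in the sides of the box that an alternating sum of Gaussian binomials also satisfies,
with matching behavior at the extreme ranks (`frobeniusGenFun_eq_rankSum`). For a large box each
relevant binomial tends to `1 / (q)_∞`, which leaves the theta series
(`colorGenFun_mul_eulerProduct`).

The product formula is the Jacobi triple product, obtained as a limit of the finite `q`-binomial
theorem (`finite_jacobi_triple_product`). All limits are taken modulo `X ^ m`, where `X` is
nilpotent and infinite sums and products become finite. -/

/-! ### Gaussian binomial coefficients. -/

section QBinomial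

variable {S : Type*} [CommRing S]

/-- The Gaussian binomial coefficient `[n, k]` in `q`, which vanishes unless `0 ≤ k ≤ n`. -/
def qBinom (q : S) : ℕ → ℤ → S
  | 0, k => if k = 0 then 1 else 0
  | n + 1, k => qBinom q n (k - 1) + q ^ k.toNat * qBinom q n k

theorem qBinom_succ (q : S) (n : ℕ) (k : ℤ) :
    qBinom q (n + 1) k = qBinom q n (k - 1) + q ^ k.toNat * qBinom q n k := rfl

theorem qBinom_of_neg (q : S) (n : ℕ) {k : ℤ} (hk : k < 0) : qBinom q n k = 0 := by
  induction n generalizing k with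
  | zero => simp [qBinom, hk.ne]
  | succ n ih => rw [qBinom_succ, ih hk, ih (by omega)]; simp

theorem qBinom_of_lt (q : S) (n : ℕ) {k : ℤ} (hk : (n : ℤ) < k) : qBinom q n k = 0 := by
  induction n generalizing k with
  | zero => simp only [qBinom]; rw [if_neg (by push_cast at hk; omega)]
  | succ n ih =>
    push_cast at hk
    rw [qBinom_succ, ih (by omega), ih (by omega)]; simp

theorem qBinom_zero_right (q : S) (n : ℕ) : qBinom q n 0 = 1 := by
  induction n with
  | zero => simp [qBinom]
  | succ n ih => rw [qBinom_succ, ih, qBinom_of_neg q n (by norm_num)]; simp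

theorem qBinom_self (q : S) (n : ℕ) : qBinom q n n = 1 := by
  induction n with
  | zero => simp [qBinom]
  | succ n ih =>
    rw [qBinom_succ, qBinom_of_lt q n (k := ((n + 1 : ℕ) : ℤ)) (by push_cast; omega)]
    simp [ih]

theorem qBinom_succ' (q : S) (n : ℕ) (k : ℤ) :
    qBinom q (n + 1) k = q ^ (n + 1 - k).toNat * qBinom q n (k - 1) + qBinom q n k := by
  induction n generalizing k with
  | zero =>
    rw [qBinom_succ]
    simp only [qBinom]
    rcases eq_or_ne k 0 with rfl | h0
    · simp
    · rcases eq_or_ne k 1 with rfl | h1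
      · simp
      · simp [h0, sub_eq_zero, h1]
  | succ n ih =>
    rw [qBinom_succ]
    have a0 := ih k
    have a1 := ih (k - 1)
    have s0 := qBinom_succ q n k
    have s1 := qBinom_succ q n (k - 1)
    -- Both sides have total exponent `n + 1` when `0 ≤ k - 1 ≤ n`; outside that range `toNat` may
    -- truncate, but the binomial vanishes.
    have key : q ^ k.toNat * q ^ ((n : ℤ) + 1 - k).toNat * qBinom q n (k - 1) =
        q ^ (((n + 1 : ℕ) : ℤ) + 1 - k).toNat * q ^ (k - 1).toNat * qBinom q n (k - 1) := by
      rcases lt_or_ge (k - 1) 0 with h | h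
      · simp [qBinom_of_neg q n h]
      rcases lt_or_ge (n : ℤ) (k - 1) with h' | h'
      · simp [qBinom_of_lt q n h']
      rw [← pow_add, ← pow_add]
      congr 2
      omega
    have e : ((n : ℤ) + 1 - (k - 1)).toNat = (((n + 1 : ℕ) : ℤ) + 1 - k).toNat := by
      push_cast; congr 1; ring
    rw [e] at a1
    linear_combination a1 + q ^ k.toNat * a0 -
      q ^ (((n + 1 : ℕ) : ℤ) + 1 - k).toNat * s1 - s0 + key

theorem qBinom_symm (q : S) (n : ℕ) (k : ℤ) : qBinom q n (n - k) = qBinom q n k := by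
  induction n generalizing k with
  | zero => simp [qBinom]
  | succ n ih =>
    rw [qBinom_succ, qBinom_succ' q n k, ← ih k, ← ih (k - 1)]
    push_cast
    rw [show (n : ℤ) + 1 - k - 1 = n - k by ring, show (n : ℤ) - (k - 1) = n + 1 - k by ring]
    ring

/-- Eliminate `[n, k + 1]` between the two Pascal rules. -/
theorem one_sub_pow_mul_qBinom_succ (q : S) (n k : ℕ) :
    (1 - q ^ (k + 1)) * qBinom q (n + 1) (k + 1 : ℕ) = (1 - q ^ (n + 1)) * qBinom q n k := by
  rcases lt_or_ge n k with h | h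
  · rw [qBinom_of_lt q n (by omega), qBinom_of_lt q (n + 1) (by omega)]; simp
  have h1 := qBinom_succ q n ((k + 1 : ℕ) : ℤ)
  have h2 := qBinom_succ' q n ((k + 1 : ℕ) : ℤ)
  rw [show (((k + 1 : ℕ) : ℤ) - 1) = k by push_cast; ring] at h1 h2
  rw [show ((n : ℤ) + 1 - ((k + 1 : ℕ) : ℤ)).toNat = n - k by omega] at h2
  rw [show (((k + 1 : ℕ) : ℤ)).toNat = k + 1 by simp] at h1
  have h3 : q ^ (n + 1) = q ^ (k + 1) * q ^ (n - k) := by rw [← pow_add]; congr 1; omega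
  rw [h3]
  linear_combination h1 - q ^ (k + 1) * h2

/-- The coefficients do not involve `k`, so any combination of binomials with fixed weights inherits
this recurrence, which is the one obeyed by partitions in a box. -/
theorem qBinom_add_two (q : S) (n : ℕ) (k : ℤ) :
    qBinom q (n + 2) k = qBinom q (n + 1) (k - 1) + qBinom q (n + 1) k -
      (1 - q ^ (n + 1)) * qBinom q n (k - 1) := by
  have h1 := qBinom_succ q (n + 1) k
  rcases lt_or_ge k 1 with h | h
  · rw [h1, qBinom_of_neg q n (by omega), Int.toNat_of_nonpos (by omega)]; simp
  obtain ⟨j, rfl⟩ : ∃ j : ℕ, k = ((j + 1 : ℕ) : ℤ) := ⟨(k - 1).toNat, by omega⟩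
  have h2 := one_sub_pow_mul_qBinom_succ q n j
  rw [show (((j + 1 : ℕ) : ℤ) - 1) = j by push_cast; ring] at *
  rw [show (((j + 1 : ℕ) : ℤ)).toNat = j + 1 by simp] at h1
  linear_combination h1 - h2

theorem qBinom_mul_prod (q : S) (a b : ℕ) :
    qBinom q (a + b) a * ∏ i ∈ Finset.range a, (1 - q ^ (i + 1)) =
      ∏ i ∈ Finset.range a, (1 - q ^ (b + i + 1)) := by
  induction a with
  | zero => simp [qBinom_zero_right]
  | succ a ih =>
    rw [Finset.prod_range_succ, Finset.prod_range_succ, ← ih, show a + 1 + b = a + b + 1 by ring]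
    have h := one_sub_pow_mul_qBinom_succ q (a + b) a
    rw [show b + a + 1 = a + b + 1 by ring]
    linear_combination (∏ i ∈ Finset.range a, (1 - q ^ (i + 1))) * h

/-- If `q ^ m = 0` then `[n, k]` is the inverse of `∏ (1 - q ^ i)` as soon as `m ≤ k ≤ n - m`. -/
theorem qBinom_mul_prod_of_pow_eq_zero {q : S} {m : ℕ} (hq : q ^ m = 0) {n T : ℕ} {k : ℤ}
    (hk : (m : ℤ) ≤ k) (hkn : k + m ≤ n) (hT : m ≤ T) :
    qBinom q n k * ∏ i ∈ Finset.range T, (1 - q ^ (i + 1)) = 1 := by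
  have hz : ∀ j, m ≤ j → q ^ j = 0 := fun j hj => pow_eq_zero_of_le hj hq
  have hP : ∀ t, m ≤ t → ∏ i ∈ Finset.range t, (1 - q ^ (i + 1)) =
      ∏ i ∈ Finset.range m, (1 - q ^ (i + 1)) := by
    intro t ht
    obtain ⟨d, rfl⟩ := Nat.exists_eq_add_of_le ht
    rw [Finset.prod_range_add, Finset.prod_eq_one (s := Finset.range d), mul_one]
    intro i _
    rw [hz _ (by omega), sub_zero]
  obtain ⟨a, rfl⟩ : ∃ a : ℕ, k = a := ⟨k.toNat, by omega⟩
  obtain ⟨b, rfl⟩ : ∃ b : ℕ, n = a + b := ⟨n - a, by omega⟩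
  rw [hP T hT, ← hP a (by omega), qBinom_mul_prod]
  exact Finset.prod_eq_one fun i _ => by rw [hz _ (by omega), sub_zero]

/-- The homogeneous `q`-binomial theorem. -/
theorem prod_add_mul_pow_eq_sum (q a b : S) (n : ℕ) :
    ∏ i ∈ Finset.range n, (a + b * q ^ i) =
      ∑ k ∈ Finset.range (n + 1), q ^ (k.choose 2) * b ^ k * a ^ (n - k) * qBinom q n k := by
  induction n with
  | zero => simp [qBinom]
  | succ n ih =>
    rw [Finset.prod_range_succ, ih, mul_add, Finset.sum_mul, Finset.sum_mul]
    have hR : ∀ k ∈ Finset.range (n + 1 + 1),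
        q ^ (k.choose 2) * b ^ k * a ^ (n + 1 - k) * qBinom q (n + 1) k =
        q ^ (k.choose 2) * b ^ k * a ^ (n + 1 - k) * qBinom q n k +
        q ^ (k.choose 2) * b ^ k * a ^ (n + 1 - k) *
          (q ^ (n + 1 - (k : ℤ)).toNat * qBinom q n (k - 1)) := by
      intro k _
      rw [qBinom_succ']; ring
    rw [Finset.sum_congr rfl hR, Finset.sum_add_distrib]
    congr 1
    · rw [Finset.sum_range_succ _ (n + 1), qBinom_of_lt q n (by push_cast; omega), mul_zero,
        add_zero]
      refine Finset.sum_congr rfl fun k hk => ?_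
      rw [show n + 1 - k = n - k + 1 by have := Finset.mem_range.1 hk; omega, pow_succ]
      ring
    · rw [Finset.sum_range_succ' _ (n + 1), qBinom_of_neg q n (by norm_num), mul_zero, mul_zero,
        add_zero]
      refine Finset.sum_congr rfl fun k hk => ?_
      have hk' := Finset.mem_range.1 hk
      rw [show (((k + 1 : ℕ) : ℤ) - 1) = k by push_cast; ring,
        show ((n : ℤ) + 1 - ((k + 1 : ℕ) : ℤ)).toNat = n - k by omega,
        show n + 1 - (k + 1) = n - k by omega, Nat.choose_succ_succ k 1, Nat.choose_one_right,
        show q ^ n = q ^ k * q ^ (n - k) by rw [← pow_add]; congr 1; omega]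
      ring

end QBinomial

/-! ### The alternating sum: recurrence and boundary behavior. -/

section AlternatingSum

variable {S : Type*} [CommRing S]

/-- The term of even index `2 * i` in the alternating sum `rankSum`. -/
def rankTermEven (q : S) (K r N M : ℕ) (i : ℤ) : S :=
  q ^ thetaExponent K r (2 * i) * qBinom q (N + M) (N + K * i)

/-- The term of odd index `2 * i + 1` in the alternating sum `rankSum`, without its sign. -/
def rankTermOdd (q : S) (K r N M : ℕ) (i : ℤ) : S :=
  q ^ thetaExponent K r (2 * i + 1) * qBinom q (N + M) (N + r - K * (i + 1))

/-- The alternating sum of Gaussian binomial coefficients that counts the partitions in a box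
with bounded successive ranks. -/
def rankSum (q : S) (K r B N M : ℕ) : S :=
  ∑ i ∈ Finset.range (2 * B + 1),
    (rankTermEven q K r N M ((i : ℤ) - B) - rankTermOdd q K r N M ((i : ℤ) - B))

theorem rankTermEven_rec (q : S) (K r N M : ℕ) (i : ℤ) :
    rankTermEven q K r (N + 1) (M + 1) i =
      rankTermEven q K r N (M + 1) i + rankTermEven q K r (N + 1) M i -
        (1 - q ^ (N + M + 1)) * rankTermEven q K r N M i := by
  unfold rankTermEven
  rw [show N + 1 + (M + 1) = N + M + 2 by ring, show N + (M + 1) = N + M + 1 by ring,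
    show N + 1 + M = N + M + 1 by ring, qBinom_add_two]
  push_cast
  rw [show (N : ℤ) + 1 + K * i - 1 = N + K * i by ring]
  ring

theorem rankTermOdd_rec (q : S) (K r N M : ℕ) (i : ℤ) :
    rankTermOdd q K r (N + 1) (M + 1) i =
      rankTermOdd q K r N (M + 1) i + rankTermOdd q K r (N + 1) M i -
        (1 - q ^ (N + M + 1)) * rankTermOdd q K r N M i := by
  unfold rankTermOdd
  rw [show N + 1 + (M + 1) = N + M + 2 by ring, show N + (M + 1) = N + M + 1 by ring,
    show N + 1 + M = N + M + 1 by ring, qBinom_add_two]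
  push_cast
  rw [show (N : ℤ) + 1 + r - K * (i + 1) - 1 = N + r - K * (i + 1) by ring]
  ring

theorem rankSum_rec (q : S) (K r B N M : ℕ) :
    rankSum q K r B (N + 1) (M + 1) =
      rankSum q K r B N (M + 1) + rankSum q K r B (N + 1) M -
        (1 - q ^ (N + M + 1)) * rankSum q K r B N M := by
  unfold rankSum
  rw [Finset.mul_sum, ← Finset.sum_add_distrib, ← Finset.sum_sub_distrib]
  refine Finset.sum_congr rfl fun i _ => ?_
  rw [rankTermEven_rec, rankTermOdd_rec]
  ring

theorem thetaExponent_zero (K r : ℕ) : thetaExponent K r 0 = 0 := by simp [thetaExponent]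

theorem thetaExponent_two_mul {K r : ℕ} (h : 2 * r ≤ K) (i : ℤ) :
    (thetaExponent K r (2 * i) : ℤ) = i * (2 * K * i + K - 2 * r) := by
  have := two_mul_thetaExponent K r h (2 * i)
  linarith

theorem thetaExponent_two_mul_add_one {K r : ℕ} (h : 2 * r ≤ K) (i : ℤ) :
    (thetaExponent K r (2 * i + 1) : ℤ) = (2 * i + 1) * (K * i + K - r) := by
  have := two_mul_thetaExponent K r h (2 * i + 1)
  linarith

/-- Only the term of index `0` survives if all the others have their lower entry out of range. -/
theorem rankSum_eq_one (q : S) {K r B N M : ℕ}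
    (h0 : qBinom q (N + M) N = 1)
    (hE : ∀ i : ℤ, i ≠ 0 → qBinom q (N + M) (N + K * i) = 0)
    (hO : ∀ i : ℤ, qBinom q (N + M) (N + r - K * (i + 1)) = 0) :
    rankSum q K r B N M = 1 := by
  unfold rankSum
  rw [Finset.sum_eq_single B]
  · simp only [rankTermEven, rankTermOdd, hO]
    simp [thetaExponent_zero, h0]
  · intro i _ hi
    rw [rankTermEven, rankTermOdd, hO, hE _ (by omega)]
    simp
  · intro h
    simp at h
    omega

theorem rankSum_zero_right (q : S) {K r B N : ℕ} (hr : 0 < r) (hN : N + r < K) :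
    rankSum q K r B N 0 = 1 := by
  apply rankSum_eq_one
  · exact qBinom_self q N
  · intro i hi
    rcases lt_or_gt_of_ne hi with h | h
    · exact qBinom_of_neg q _ (by nlinarith)
    · exact qBinom_of_lt q _ (by push_cast; nlinarith)
  · intro i
    rcases lt_or_ge i 0 with h | h
    · exact qBinom_of_lt q _ (by push_cast; nlinarith)
    · exact qBinom_of_neg q _ (by nlinarith)

theorem rankSum_zero_left (q : S) {K r B M : ℕ} (hM : M < r) (hr : 2 * r ≤ K) :
    rankSum q K r B 0 M = 1 := by
  apply rankSum_eq_one
  · exact qBinom_zero_right q _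
  · intro i hi
    rcases lt_or_gt_of_ne hi with h | h
    · exact qBinom_of_neg q _ (by push_cast; nlinarith)
    · exact qBinom_of_lt q _ (by push_cast; nlinarith)
  · intro i
    rcases lt_or_ge i 0 with h | h
    · exact qBinom_of_lt q _ (by push_cast; nlinarith)
    · exact qBinom_of_neg q _ (by push_cast; nlinarith)

/-- The symmetry `k ↦ n - k`, in the form that cancels an even term of `rankSum` against an odd one
on the boundary lines. -/
theorem pow_mul_qBinom_reflect (q : S) {n : ℕ} {k k' : ℤ} {a b : ℕ} (hk : k + k' = n)
    (hab : (a : ℤ) + k = b + k') :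
    q ^ a * (q ^ k.toNat * qBinom q n k) = q ^ b * (q ^ k'.toNat * qBinom q n k') := by
  obtain rfl : k' = n - k := by omega
  rw [qBinom_symm]
  rcases lt_or_ge k 0 with h | h
  · simp [qBinom_of_neg q n h]
  rcases lt_or_ge (n : ℤ) k with h' | h'
  · simp [qBinom_of_lt q n h']
  rw [← mul_assoc, ← mul_assoc, ← pow_add, ← pow_add]
  congr 2
  omega

/-- On this line the increments of the even and odd terms of the same index `i` are reflections of
each other, so they cancel termwise, whatever `B` is. -/
theorem rankSum_succ_left (q : S) {K r B N M : ℕ} (hr : 2 * r ≤ K) (h : N + 1 + r + 1 = M + K) :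
    rankSum q K r B (N + 1) M = rankSum q K r B N M := by
  unfold rankSum
  refine Finset.sum_congr rfl fun j _ => ?_
  generalize (j : ℤ) - B = i
  unfold rankTermEven rankTermOdd
  rw [show N + 1 + M = N + M + 1 by ring, qBinom_succ, qBinom_succ]
  have key := pow_mul_qBinom_reflect q (n := N + M) (k := ((N + 1 : ℕ) : ℤ) + K * i)
    (k' := ((N + 1 : ℕ) : ℤ) + r - K * (i + 1)) (a := thetaExponent K r (2 * i))
    (b := thetaExponent K r (2 * i + 1))
    (by have : (N : ℤ) + 1 + r + 1 = M + K := by exact_mod_cast h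
        push_cast; linarith)
    (by rw [thetaExponent_two_mul hr, thetaExponent_two_mul_add_one hr]; ring)
  rw [show ((N + 1 : ℕ) : ℤ) + K * i - 1 = N + K * i by push_cast; ring,
    show ((N + 1 : ℕ) : ℤ) + r - K * (i + 1) - 1 = N + r - K * (i + 1) by push_cast; ring]
  linear_combination key

/-- Here the increment of the even term `i` matches that of the odd term `i - 1`. The sum
telescopes, and `B` must be large enough for both end terms to vanish. -/
theorem rankSum_succ_right (q : S) {K r B N M : ℕ} (hr : 2 * r ≤ K) (hr0 : 0 < r)
    (h : M + 1 + 1 = N + r) (hB : N + M < B) :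
    rankSum q K r B N (M + 1) = rankSum q K r B N M := by
  set O : ℤ → S := fun i => rankTermOdd q K r N (M + 1) i - rankTermOdd q K r N M i with hO
  have hE : ∀ i, rankTermEven q K r N (M + 1) i - rankTermEven q K r N M i = O (i - 1) := by
    intro i
    simp only [hO]
    unfold rankTermEven rankTermOdd
    rw [show N + (M + 1) = N + M + 1 by ring, qBinom_succ', qBinom_succ']
    have key := pow_mul_qBinom_reflect q (n := N + M) (k := (N : ℤ) + M + 1 - (N + K * i))
      (k' := (N : ℤ) + M + 1 - (N + r - K * (i - 1 + 1))) (a := thetaExponent K r (2 * i))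
      (b := thetaExponent K r (2 * (i - 1) + 1))
      (by have : (M : ℤ) + 1 + 1 = N + r := by exact_mod_cast h
          push_cast; linarith)
      (by rw [thetaExponent_two_mul hr, thetaExponent_two_mul_add_one hr]; ring)
    rw [← qBinom_symm q (N + M) (_ - _), ← qBinom_symm q (N + M) ((N : ℤ) + M + 1 - _)] at key
    push_cast at key ⊢
    rw [show (N : ℤ) + M - (N + M + 1 - (N + K * i)) = N + K * i - 1 by ring,
      show (N : ℤ) + M - (N + M + 1 - (N + r - K * (i - 1 + 1))) = N + r - K * (i - 1 + 1) - 1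
        by ring] at key
    linear_combination key
  have hO1 : O B = 0 := by
    simp only [hO, rankTermOdd]
    rw [qBinom_of_neg q _ (by nlinarith), qBinom_of_neg q _ (by nlinarith)]; simp
  have hO2 : O (-B - 1) = 0 := by
    simp only [hO, rankTermOdd]
    rw [qBinom_of_lt q _ (by push_cast; nlinarith), qBinom_of_lt q _ (by push_cast; nlinarith)]
    simp
  rw [← sub_eq_zero]
  unfold rankSum
  rw [← Finset.sum_sub_distrib]
  have ht : ∀ j ∈ Finset.range (2 * B + 1),
      rankTermEven q K r N (M + 1) ((j : ℤ) - B) - rankTermOdd q K r N (M + 1) ((j : ℤ) - B) -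
        (rankTermEven q K r N M ((j : ℤ) - B) - rankTermOdd q K r N M ((j : ℤ) - B)) =
      (fun j : ℕ => -O ((j : ℤ) - B - 1)) (j + 1) - (fun j : ℕ => -O ((j : ℤ) - B - 1)) j := by
    intro j _
    have := hE ((j : ℤ) - B)
    simp only
    rw [show (((j + 1 : ℕ) : ℤ) - B - 1) = j - B by push_cast; ring, ← this]
    simp only [hO]
    ring
  rw [Finset.sum_congr rfl ht, Finset.sum_range_sub (fun j : ℕ => -O ((j : ℤ) - B - 1)) (2 * B + 1)]
  rw [show (((2 * B + 1 : ℕ) : ℤ) - B - 1) = B by push_cast; ring,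
    show (((0 : ℕ) : ℤ) - B - 1) = -B - 1 by push_cast; ring, hO1, hO2]
  simp

end AlternatingSum

/-! ### Frobenius symbols with bounded ranks in a box. -/

section Frobenius

/-- The Frobenius symbols of the partitions of `n` with at most `M` parts, all of them at most `N`,
such that `R a b` holds for each column `(a, b)`. -/
def frobeniusSymbols (R : ℕ → ℕ → Prop) (N M n : ℕ) : Set (List (ℕ × ℕ)) :=
  {l | l.IsChain (fun p p' => p'.1 < p.1 ∧ p'.2 < p.2) ∧
    (∀ p ∈ l, R p.1 p.2 ∧ p.1 < N ∧ p.2 < M) ∧ (l.map fun p => p.1 + p.2 + 1).sum = n}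

variable (R : ℕ → ℕ → Prop)

theorem nil_mem_frobeniusSymbols {N M n : ℕ} : [] ∈ frobeniusSymbols R N M n ↔ n = 0 := by
  simp [frobeniusSymbols, eq_comm]

/-- Since both rows decrease strictly, the first column bounds all the others: the tail is a symbol
in the box `a × b`. -/
theorem cons_mem_frobeniusSymbols {N M n a b : ℕ} {l : List (ℕ × ℕ)} :
    (a, b) :: l ∈ frobeniusSymbols R N M n ↔
      R a b ∧ a < N ∧ b < M ∧ a + b + 1 ≤ n ∧
        l ∈ frobeniusSymbols R a b (n - (a + b + 1)) := by
  have : IsTrans (ℕ × ℕ) (fun p p' => p'.1 < p.1 ∧ p'.2 < p.2) :=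
    ⟨fun _ _ _ h h' => ⟨h'.1.trans h.1, h'.2.trans h.2⟩⟩
  simp only [frobeniusSymbols, Set.mem_ofPred_eq, List.isChain_iff_pairwise, List.pairwise_cons,
    List.forall_mem_cons, List.map_cons, List.sum_cons]
  constructor
  · rintro ⟨⟨h1, h2⟩, ⟨⟨h3, h4, h5⟩, h6⟩, h7⟩
    exact ⟨h3, h4, h5, by omega, h2, fun p hp => ⟨(h6 p hp).1, h1 p hp⟩, by omega⟩
  · rintro ⟨h3, h4, h5, h6, h2, h1, h7⟩
    exact ⟨⟨fun p hp => (h1 p hp).2, h2⟩, ⟨⟨h3, h4, h5⟩, fun p hp =>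
      ⟨(h1 p hp).1, (h1 p hp).2.1.trans h4, (h1 p hp).2.2.trans h5⟩⟩, by omega⟩

theorem frobeniusSymbols_finite (N M n : ℕ) : (frobeniusSymbols R N M n).Finite := by
  induction n using Nat.strong_induction_on generalizing N M with
  | _ n ih =>
    have hU : (⋃ a ∈ Set.Iio N, ⋃ b ∈ Set.Iio M,
        List.cons (a, b) '' {l | a + b + 1 ≤ n ∧
          l ∈ frobeniusSymbols R a b (n - (a + b + 1))}).Finite := by
      refine (Set.finite_Iio N).biUnion fun a _ => (Set.finite_Iio M).biUnion fun b _ => ?_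
      refine Set.Finite.image _ ?_
      by_cases h : a + b + 1 ≤ n
      · exact (ih _ (by omega) a b).subset fun l hl => hl.2
      · simp [h]
    refine (hU.insert []).subset ?_
    rintro (_ | ⟨⟨a, b⟩, l⟩) hl
    · simp
    · rw [cons_mem_frobeniusSymbols] at hl
      refine Or.inr ?_
      simp only [Set.mem_iUnion]
      exact ⟨a, hl.2.1, b, hl.2.2.1, l, hl.2.2.2, rfl⟩

/-- A symbol in the larger box either fits in one of the two boxes with one side shortened, whose
intersection is the small box, or starts with the column `(N, M)`. -/
theorem ncard_frobeniusSymbols_rec [∀ a b, Decidable (R a b)] (N M n : ℕ) :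
    (frobeniusSymbols R (N + 1) (M + 1) n).ncard + (frobeniusSymbols R N M n).ncard =
      (frobeniusSymbols R N (M + 1) n).ncard + (frobeniusSymbols R (N + 1) M n).ncard +
      if R N M ∧ N + M + 1 ≤ n then (frobeniusSymbols R N M (n - (N + M + 1))).ncard else 0 := by
  have hinter : frobeniusSymbols R N M n =
      frobeniusSymbols R N (M + 1) n ∩ frobeniusSymbols R (N + 1) M n := by
    ext l
    constructor
    · rintro ⟨h1, h2, h3⟩
      exact ⟨⟨h1, fun p hp => ⟨(h2 p hp).1, (h2 p hp).2.1, by have := (h2 p hp).2.2; omega⟩, h3⟩,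
        ⟨h1, fun p hp => ⟨(h2 p hp).1, by have := (h2 p hp).2.1; omega, (h2 p hp).2.2⟩, h3⟩⟩
    · rintro ⟨⟨h1, h2, h3⟩, ⟨-, h4, -⟩⟩
      exact ⟨h1, fun p hp => ⟨(h2 p hp).1, (h2 p hp).2.1, (h4 p hp).2.2⟩, h3⟩
  set T : Set (List (ℕ × ℕ)) := List.cons (N, M) ''
    {l | R N M ∧ N + M + 1 ≤ n ∧ l ∈ frobeniusSymbols R N M (n - (N + M + 1))} with hT
  have hTcard : T.ncard =
      if R N M ∧ N + M + 1 ≤ n then (frobeniusSymbols R N M (n - (N + M + 1))).ncard else 0 := by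
    rw [hT, Set.ncard_image_of_injective _ (List.cons_injective)]
    split_ifs with h
    · simp [h.1, h.2]
    · rw [Set.ncard_eq_zero (Set.Finite.subset (frobeniusSymbols_finite R _ _ _) fun l hl => hl.2.2)]
      exact Set.eq_empty_of_forall_notMem fun l hl => h ⟨hl.1, hl.2.1⟩
  have hunion : frobeniusSymbols R (N + 1) (M + 1) n =
      (frobeniusSymbols R N (M + 1) n ∪ frobeniusSymbols R (N + 1) M n) ∪ T := by
    ext l
    rcases l with _ | ⟨⟨a, b⟩, l⟩
    · simp [nil_mem_frobeniusSymbols, hT]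
    · simp only [Set.mem_union, cons_mem_frobeniusSymbols, hT, Set.mem_image, List.cons.injEq,
        Prod.mk.injEq, Set.mem_ofPred_eq]
      constructor
      · rintro ⟨h1, h2, h3, h4⟩
        by_cases ha : a < N
        · exact Or.inl (Or.inl ⟨h1, ha, h3, h4⟩)
        by_cases hb : b < M
        · exact Or.inl (Or.inr ⟨h1, h2, hb, h4⟩)
        obtain rfl : a = N := by omega
        obtain rfl : b = M := by omega
        exact Or.inr ⟨l, ⟨h1, h4⟩, ⟨rfl, rfl⟩, rfl⟩
      · rintro ((⟨h1, h2, h3, h4⟩ | ⟨h1, h2, h3, h4⟩) | ⟨l', ⟨h1, h4⟩, ⟨rfl, rfl⟩, rfl⟩)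
        · exact ⟨h1, by omega, h3, h4⟩
        · exact ⟨h1, h2, by omega, h4⟩
        · exact ⟨h1, by omega, by omega, h4⟩
  have hdisj : Disjoint (frobeniusSymbols R N (M + 1) n ∪ frobeniusSymbols R (N + 1) M n) T := by
    rw [Set.disjoint_right]
    rintro _ ⟨l, -, rfl⟩ h
    simp only [Set.mem_union, cons_mem_frobeniusSymbols] at h
    omega
  have hfT : T.Finite := by
    refine Set.Finite.subset (frobeniusSymbols_finite R (N + 1) (M + 1) n) ?_
    rw [hunion]
    exact Set.subset_union_right
  rw [hunion, Set.ncard_union_eq hdisj ((frobeniusSymbols_finite R _ _ _).union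
    (frobeniusSymbols_finite R _ _ _)) hfT, hTcard, hinter,
    ← Set.ncard_union_add_ncard_inter _ _ (frobeniusSymbols_finite R _ _ _)
      (frobeniusSymbols_finite R _ _ _), ← hinter]
  omega

/-- The generating function of the cardinalities of `frobeniusSymbols R N M n`. -/
noncomputable def frobeniusGenFun (N M : ℕ) : ℚ⟦X⟧ :=
  PowerSeries.mk fun n => ((frobeniusSymbols R N M n).ncard : ℚ)

theorem frobeniusGenFun_rec [∀ a b, Decidable (R a b)] (N M : ℕ) :
    frobeniusGenFun R (N + 1) (M + 1) + frobeniusGenFun R N M =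
      frobeniusGenFun R N (M + 1) + frobeniusGenFun R (N + 1) M +
        if R N M then X ^ (N + M + 1) * frobeniusGenFun R N M else 0 := by
  ext n
  have h := ncard_frobeniusSymbols_rec R N M n
  have h' := congrArg (Nat.cast : ℕ → ℚ) h
  push_cast at h'
  simp only [map_add, frobeniusGenFun, coeff_mk, h']
  congr 1
  by_cases h1 : R N M
  · simp [h1, coeff_X_pow_mul']
  · simp [h1]

theorem frobeniusGenFun_eq_one {N M : ℕ} (h : N = 0 ∨ M = 0) : frobeniusGenFun R N M = 1 := by
  have hs : ∀ n, frobeniusSymbols R N M n = {l | l = [] ∧ n = 0} := by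
    intro n
    ext l
    rcases l with _ | ⟨⟨a, b⟩, l⟩
    · simp [nil_mem_frobeniusSymbols]
    · simp [cons_mem_frobeniusSymbols]
      omega
  ext n
  rw [frobeniusGenFun, coeff_mk, hs, coeff_one]
  split_ifs with hn
  · simp [hn]
  · simp [hn]

theorem frobeniusGenFun_succ_left {N M : ℕ} (h : ∀ b < M, ¬ R N b) :
    frobeniusGenFun R (N + 1) M = frobeniusGenFun R N M := by
  ext n
  simp only [frobeniusGenFun, coeff_mk]
  congr 2
  ext l
  rcases l with _ | ⟨⟨a, b⟩, l⟩
  · simp [nil_mem_frobeniusSymbols]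
  · simp only [cons_mem_frobeniusSymbols]
    constructor
    · rintro ⟨h1, h2, h3, h4⟩
      refine ⟨h1, lt_of_le_of_ne (by omega) ?_, h3, h4⟩
      rintro rfl
      exact h b h3 h1
    · rintro ⟨h1, h2, h3, h4⟩
      exact ⟨h1, by omega, h3, h4⟩

theorem frobeniusGenFun_succ_right {N M : ℕ} (h : ∀ a < N, ¬ R a M) :
    frobeniusGenFun R N (M + 1) = frobeniusGenFun R N M := by
  ext n
  simp only [frobeniusGenFun, coeff_mk]
  congr 2
  ext l
  rcases l with _ | ⟨⟨a, b⟩, l⟩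
  · simp [nil_mem_frobeniusSymbols]
  · simp only [cons_mem_frobeniusSymbols]
    constructor
    · rintro ⟨h1, h2, h3, h4⟩
      refine ⟨h1, h2, lt_of_le_of_ne (by omega) ?_, h4⟩
      rintro rfl
      exact h a h2 h1
    · rintro ⟨h1, h2, h3, h4⟩
      exact ⟨h1, h2, by omega, h4⟩

/-- The successive rank `a - b` lies between `2 - r` and `K - r - 2`. -/
def RankBounded (K r a b : ℕ) : Prop := b + 2 ≤ a + r ∧ a + r + 2 ≤ b + K

instance (K r a b : ℕ) : Decidable (RankBounded K r a b) :=
  inferInstanceAs (Decidable (_ ∧ _))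

/-- The partitions in a box with bounded successive ranks are counted by `rankSum`. -/
theorem frobeniusGenFun_eq_rankSum {K r : ℕ} (hK : 3 ≤ K) (hr0 : 0 < r) (hr : 2 * r ≤ K)
    (B N M : ℕ) (hB : N + M ≤ B) (h1 : M + 1 ≤ N + r) (h2 : N + r + 1 ≤ M + K) :
    frobeniusGenFun (RankBounded K r) N M = rankSum X K r B N M := by
  induction hs : N + M using Nat.strong_induction_on generalizing N M with
  | _ s ih =>
    rcases Nat.eq_zero_or_pos M with rfl | hM
    · rw [frobeniusGenFun_eq_one _ (Or.inr rfl), rankSum_zero_right X hr0 (by omega)]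
    rcases Nat.eq_zero_or_pos N with rfl | hN
    · rw [frobeniusGenFun_eq_one _ (Or.inl rfl), rankSum_zero_left X (by omega) hr]
    obtain ⟨N, rfl⟩ := Nat.exists_eq_succ_of_ne_zero hN.ne'
    obtain ⟨M, rfl⟩ := Nat.exists_eq_succ_of_ne_zero hM.ne'
    simp only [Nat.succ_eq_add_one] at *
    -- Strictly between the two boundary lines the new corner `(N, M)` has an admissible rank and
    -- the recurrence applies. On a boundary line every column with the new extreme entry violates a
    -- rank bound, so a side can be shortened.
    rcases Nat.lt_or_ge (N + 1 + r + 1) (M + 1 + K) with h3 | h3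
    · rcases Nat.lt_or_ge (M + 1 + 1) (N + 1 + r) with h4 | h4
      · have hrec := frobeniusGenFun_rec (RankBounded K r) N M
        rw [if_pos ⟨by omega, by omega⟩,
          ih (N + M) (by omega) N M (by omega) (by omega) (by omega) rfl,
          ih (N + (M + 1)) (by omega) N (M + 1) (by omega) (by omega) (by omega) rfl,
          ih (N + 1 + M) (by omega) (N + 1) M (by omega) (by omega) (by omega) rfl] at hrec
        rw [rankSum_rec]
        linear_combination hrec
      · rw [rankSum_succ_right X hr hr0 (by omega) (by omega), frobeniusGenFun_succ_right,
          ih (N + 1 + M) (by omega) (N + 1) M (by omega) (by omega) (by omega) rfl]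
        intro a ha h
        unfold RankBounded at h
        omega
    · rw [rankSum_succ_left X hr (by omega), frobeniusGenFun_succ_left,
        ih (N + (M + 1)) (by omega) N (M + 1) (by omega) (by omega) (by omega) rfl]
      intro b hb h
      unfold RankBounded at h
      omega

end Frobenius

/-! ### Colored partitions as Frobenius symbols. -/

section ColorPartitions

/-- The column of a Frobenius symbol that corresponds to a part of size `p.1` and color `p.2`. -/
def frobeniusColumn (r : ℕ) (p : ℕ × ℕ) : ℕ × ℕ :=
  if p.1 ≡ r [MOD 2] then ((p.1 + 2 * p.2 - r) / 2, (p.1 + r - 2 * p.2 - 2) / 2)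
  else ((p.1 + 2 * p.2 - r - 1) / 2, (p.1 + r - 2 * p.2 - 1) / 2)

/-- The inverse of `frobeniusColumn`. -/
def coloredPart (r : ℕ) (p : ℕ × ℕ) : ℕ × ℕ := (p.1 + p.2 + 1, (p.1 + r - p.2) / 2)

theorem coloredPart_frobeniusColumn {r a c : ℕ} (h : initialBound r a c < a) :
    coloredPart r (frobeniusColumn r (a, c)) = (a, c) := by
  unfold initialBound at h
  unfold coloredPart frobeniusColumn
  dsimp only
  split_ifs at * with h1 <;> rw [abs_lt] at h <;> rw [Nat.ModEq] at h1 <;>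
    simp only [Prod.mk.injEq] <;> omega

theorem frobeniusColumn_coloredPart {r a b : ℕ} (h : b + 2 ≤ a + r) :
    frobeniusColumn r (coloredPart r (a, b)) = (a, b) := by
  unfold coloredPart frobeniusColumn
  dsimp only
  split_ifs with h1 <;> rw [Nat.ModEq] at h1 <;> simp only [Prod.mk.injEq] <;> omega

theorem initialBound_coloredPart {r a b : ℕ} (h : b + 2 ≤ a + r) :
    initialBound r (coloredPart r (a, b)).1 (coloredPart r (a, b)).2 <
      ((coloredPart r (a, b)).1 : ℤ) := by
  unfold coloredPart initialBound
  dsimp only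
  split_ifs with h1 <;> rw [Nat.ModEq] at h1 <;> rw [abs_lt] <;> omega

/-- In all three cases the absolute value is the difference of the ranks. With `x = a - a'`, `y = b
- b'` the condition is `x + y ≥ 2 + |x - y|`, i.e. `min x y ≥ 1`. -/
theorem gapBound_coloredPart_iff {r a b a' b' : ℕ} (h : b + 2 ≤ a + r) (h' : b' + 2 ≤ a' + r) :
    gapBound r (coloredPart r (a, b)).1 (coloredPart r (a, b)).2 (coloredPart r (a', b')).1
        (coloredPart r (a', b')).2 ≤
      ((coloredPart r (a, b)).1 : ℤ) - ((coloredPart r (a', b')).1 : ℤ) ↔ a' < a ∧ b' < b := by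
  unfold coloredPart gapBound
  dsimp only
  split_ifs with h1 h2
  · rw [Nat.ModEq] at h1
    rw [← le_sub_iff_add_le', abs_le]; omega
  · rw [Nat.ModEq] at h1 h2
    rw [← le_sub_iff_add_le', abs_le]; omega
  · rw [Nat.ModEq] at h1 h2
    rw [← le_sub_iff_add_le', abs_le]; omega

/-- The color is `⌊(rank + r) / 2⌋`, so its range gives `2 ≤ rank + r ≤ 2 * (M / 2) - 1`. For even
`M` this still admits `rank + r = M - 1`, which is exactly what (iii) excludes. -/
theorem rankBounded_frobeniusColumn {M r a c : ℕ} (h : initialBound r a c < a)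
    (hc : 1 ≤ c ∧ c ≤ M / 2 - 1) (he : Even M → c = M / 2 - 1 → ¬ a ≡ r [MOD 2]) :
    RankBounded M r (frobeniusColumn r (a, c)).1 (frobeniusColumn r (a, c)).2 := by
  unfold initialBound at h
  unfold RankBounded frobeniusColumn
  rw [Nat.even_iff, Nat.ModEq] at he
  dsimp only
  split_ifs at * with h1 <;> rw [abs_lt] at h <;> rw [Nat.ModEq] at h1 <;>
    dsimp only <;> omega

theorem coloredPart_of_rankBounded {M r a b : ℕ} (h : RankBounded M r a b) :
    (1 ≤ (coloredPart r (a, b)).2 ∧ (coloredPart r (a, b)).2 ≤ M / 2 - 1) ∧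
      (Even M → (coloredPart r (a, b)).2 = M / 2 - 1 →
        ¬ (coloredPart r (a, b)).1 ≡ r [MOD 2]) := by
  unfold RankBounded at h
  unfold coloredPart
  rw [Nat.even_iff, Nat.ModEq]
  dsimp only
  omega

/-- The colored partitions in `colorSet M r n` are in bijection with the Frobenius symbols of the
partitions of `n` all of whose successive ranks are bounded. -/
theorem ncard_colorSet {M r N n : ℕ} (hN : n ≤ N) :
    (colorSet M r n).ncard = (frobeniusSymbols (RankBounded M r) N N n).ncard := by
  have hinv : ∀ α ∈ colorSet M r n,
      (α.parts.map (frobeniusColumn r)).map (coloredPart r) = α.parts := by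
    intro α hα
    rw [List.map_map]
    refine (List.map_congr_left fun p hp => ?_).trans (List.map_id _)
    exact coloredPart_frobeniusColumn (hα.1 p hp)
  have hinj : Set.InjOn (fun α : ColorPartition (M / 2 - 1) n => α.parts.map (frobeniusColumn r))
      (colorSet M r n) := by
    intro α hα β hβ h
    have h' : α.parts = β.parts := by
      rw [← hinv α hα, ← hinv β hβ]
      exact congrArg _ h
    cases α
    cases β
    simpa using h'
  rw [← hinj.ncard_image]
  congr 1
  ext l
  constructor
  · rintro ⟨α, hα, rfl⟩
    have hrank : ∀ p ∈ α.parts,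
        RankBounded M r (frobeniusColumn r p).1 (frobeniusColumn r p).2 := fun p hp =>
      rankBounded_frobeniusColumn (hα.1 p hp) (α.color_mem p hp) fun he => hα.2.2 he p hp
    have hsize : ∀ p ∈ α.parts, (frobeniusColumn r p).1 + (frobeniusColumn r p).2 + 1 = p.1 :=
      fun p hp => congrArg Prod.fst (coloredPart_frobeniusColumn (hα.1 p hp))
    have hle : ∀ p ∈ α.parts, p.1 ≤ n := by
      intro p hp
      have h := List.single_le_sum (l := α.parts.map Prod.fst) (by simp) p.1
        (List.mem_map_of_mem hp)
      rwa [α.sum_parts] at h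
    refine ⟨?_, ?_, ?_⟩
    · rw [List.isChain_map]
      refine List.IsChain.imp_of_mem_imp (fun p p' hp hp' h => ?_) hα.2.1
      rw [← gapBound_coloredPart_iff (hrank p hp).1 (hrank p' hp').1]
      rwa [coloredPart_frobeniusColumn (hα.1 p hp), coloredPart_frobeniusColumn (hα.1 p' hp')]
    · intro q hq
      obtain ⟨p, hp, rfl⟩ := List.mem_map.1 hq
      have h1 := hsize p hp
      have h2 := hle p hp
      exact ⟨hrank p hp, by omega, by omega⟩
    · rw [List.map_map]
      exact (congrArg List.sum (List.map_congr_left hsize)).trans α.sum_parts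
  · rintro ⟨h1, h2, h3⟩
    have hgap : (l.map (coloredPart r)).IsChain
        (fun p p' => gapBound r p.1 p.2 p'.1 p'.2 ≤ (p.1 : ℤ) - (p'.1 : ℤ)) := by
      rw [List.isChain_map]
      refine List.IsChain.imp_of_mem_imp (fun p p' hp hp' h => ?_) h1
      exact (gapBound_coloredPart_iff (h2 p hp).1.1 (h2 p' hp').1.1).2 h
    refine ⟨⟨l.map (coloredPart r), ?_, ?_, ?_, ?_⟩, ⟨?_, hgap, ?_⟩, ?_⟩
    · intro q hq
      obtain ⟨p, hp, rfl⟩ := List.mem_map.1 hq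
      exact Nat.succ_pos _
    · intro q hq
      obtain ⟨p, hp, rfl⟩ := List.mem_map.1 hq
      exact (coloredPart_of_rankBounded (h2 p hp).1).1
    -- The sizes decrease strictly, so the condition on colors of equal parts is vacuous.
    · rw [List.isChain_map]
      refine h1.imp fun p p' h => ?_
      unfold coloredPart
      dsimp only
      omega
    · rw [List.map_map]
      exact h3
    · intro q hq
      obtain ⟨p, hp, rfl⟩ := List.mem_map.1 hq
      exact initialBound_coloredPart (h2 p hp).1.1
    · intro he q hq
      obtain ⟨p, hp, rfl⟩ := List.mem_map.1 hq
      exact (coloredPart_of_rankBounded (h2 p hp).1).2 he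
    · dsimp only
      rw [List.map_map]
      refine (List.map_congr_left fun p hp => ?_).trans (List.map_id _)
      exact frobeniusColumn_coloredPart (h2 p hp).1.1

theorem coeff_colorGenFun {M r N n : ℕ} (hN : n ≤ N) :
    coeff n (colorGenFun M r) = coeff n (frobeniusGenFun (RankBounded M r) N N) := by
  rw [colorGenFun, frobeniusGenFun, coeff_mk, coeff_mk, ncard_colorSet hN]

end ColorPartitions

/-! ### Power series modulo `X ^ m`. -/

section Truncation

/-- The ring of power series modulo `X ^ m`. -/
def TruncRing (m : ℕ) : Type := ℚ⟦X⟧ ⧸ Ideal.span {(X : ℚ⟦X⟧) ^ m}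

noncomputable instance (m : ℕ) : CommRing (TruncRing m) :=
  inferInstanceAs (CommRing (ℚ⟦X⟧ ⧸ Ideal.span {(X : ℚ⟦X⟧) ^ m}))

/-- Reduction of power series modulo `X ^ m`. -/
noncomputable def truncHom (m : ℕ) : ℚ⟦X⟧ →+* TruncRing m :=
  Ideal.Quotient.mk (Ideal.span {(X : ℚ⟦X⟧) ^ m})

theorem truncHom_eq_iff {m : ℕ} {f g : ℚ⟦X⟧} :
    truncHom m f = truncHom m g ↔ ∀ d < m, coeff d f = coeff d g := by
  refine Ideal.Quotient.eq.trans ?_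
  rw [Ideal.mem_span_singleton, X_pow_dvd_iff]
  simp [sub_eq_zero]

theorem truncHom_X_pow (m : ℕ) : truncHom m X ^ m = 0 := by
  rw [← map_pow]
  exact Ideal.Quotient.eq_zero_iff_mem.2 (Ideal.mem_span_singleton_self _)

theorem truncHom_X_pow_of_le {m n : ℕ} (h : m ≤ n) : truncHom m X ^ n = 0 :=
  pow_eq_zero_of_le h (truncHom_X_pow m)

theorem eq_of_truncHom_eq {f g : ℚ⟦X⟧} (h : ∀ m, truncHom m f = truncHom m g) : f = g := by
  ext d
  exact truncHom_eq_iff.1 (h (d + 1)) d d.lt_succ_self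

theorem truncHom_tsum {ι : Type*} {f : ι → ℚ⟦X⟧} (hf : Summable f) {m : ℕ} (s : Finset ι)
    (h : ∀ i ∉ s, truncHom m (f i) = 0) : truncHom m (∑' i, f i) = ∑ i ∈ s, truncHom m (f i) := by
  rw [← map_sum, truncHom_eq_iff]
  intro d hd
  refine ((PowerSeries.WithPiTopology.hasSum_iff_hasSum_coeff ℚ).1 hf.hasSum d).unique ?_
  rw [map_sum]
  refine hasSum_sum_of_ne_finset_zero fun i hi => ?_
  have h0 := h i hi
  rw [← map_zero (truncHom m), truncHom_eq_iff] at h0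
  simpa using h0 d hd

/-- All partial products over sets containing `s` agree modulo `X ^ m`, so each low coefficient is
eventually constant. -/
theorem truncHom_tprod {ι : Type*} {f : ι → ℚ⟦X⟧} (hf : Multipliable f) {m : ℕ} (s : Finset ι)
    (h : ∀ i ∉ s, truncHom m (f i) = 1) : truncHom m (∏' i, f i) = ∏ i ∈ s, truncHom m (f i) := by
  classical
  rw [← map_prod, truncHom_eq_iff]
  intro d hd
  have h1 : Filter.Tendsto (fun t => ∏ i ∈ t, f i) Filter.atTop (nhds (∏' i, f i)) := hf.hasProd
  have h2 := (PowerSeries.WithPiTopology.tendsto_iff_coeff_tendsto ℚ _ _ _).1 h1 d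
  refine tendsto_nhds_unique h2 (tendsto_const_nhds.congr' ?_)
  filter_upwards [Filter.eventually_ge_atTop s] with t ht
  refine (truncHom_eq_iff (m := m)).1 ?_ d hd
  rw [← Finset.prod_sdiff ht, map_mul, map_prod (truncHom m) f (t \ s),
    Finset.prod_eq_one fun i hi => h i (Finset.mem_sdiff.1 hi).2, one_mul]

theorem truncHom_eulerProduct {m T : ℕ} (h : m ≤ T) :
    truncHom m (∏' n : ℕ, (1 - X ^ (n + 1) : ℚ⟦X⟧)) =
      ∏ i ∈ Finset.range T, (1 - truncHom m X ^ (i + 1)) := by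
  rw [truncHom_tprod (PowerSeries.WithPiTopology.multipliable_one_sub_X_pow ℚ) (Finset.range T)]
  · simp
  · intro i hi
    rw [Finset.mem_range, not_lt] at hi
    rw [map_sub, map_one, map_pow, truncHom_X_pow_of_le (by omega), sub_zero]

theorem map_qBinom {S T : Type*} [CommRing S] [CommRing T] (f : S →+* T) (q : S) (n : ℕ) (k : ℤ) :
    f (qBinom q n k) = qBinom (f q) n k := by
  induction n generalizing k with
  | zero => simp only [qBinom]; split_ifs <;> simp
  | succ n ih => simp [qBinom_succ, ih]

theorem map_rankSum {S T : Type*} [CommRing S] [CommRing T] (f : S →+* T) (q : S)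
    (K r B N M : ℕ) : f (rankSum q K r B N M) = rankSum (f q) K r B N M := by
  simp [rankSum, rankTermEven, rankTermOdd, map_qBinom]

end Truncation

/-! ### The theta series and the finite triple product. -/

section ThetaSeries

/-- This growth gives summability and shows that only `|j| < m` matters modulo `X ^ m`. The products
`h1` in the proof are twice the difference of the two sides. -/
theorem natAbs_le_thetaExponent {M r : ℕ} (hM : 3 ≤ M) (hr : 0 < r) (hrM : 2 * r ≤ M) (j : ℤ) :
    j.natAbs ≤ thetaExponent M r j := by
  have h := two_mul_thetaExponent M r hrM j
  have hM' : (3 : ℤ) ≤ M := by exact_mod_cast hM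
  have hr' : (1 : ℤ) ≤ r := by exact_mod_cast hr
  have hrM' : (2 * r : ℤ) ≤ M := by exact_mod_cast hrM
  zify
  rcases lt_trichotomy j 0 with hj | rfl | hj
  · rw [abs_of_neg hj]
    have h1 : 0 ≤ -j * ((M : ℤ) * (-j - 1) + 2 * (r - 1)) :=
      mul_nonneg (by omega) (add_nonneg (mul_nonneg (by omega) (by omega)) (by omega))
    nlinarith
  · simp
  · rw [abs_of_pos hj]
    have h1 : 0 ≤ j * ((M : ℤ) * (j - 1) + (M - 2) + (M - 2 * r)) :=
      mul_nonneg (by omega) (add_nonneg (add_nonneg (mul_nonneg (by omega) (by omega))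
        (by omega)) (by omega))
    nlinarith

theorem summable_theta {M r : ℕ} (hM : 3 ≤ M) (hr : 0 < r) (hrM : 2 * r ≤ M) :
    Summable (fun j : ℤ => ((-1) ^ j.natAbs * X ^ thetaExponent M r j : ℚ⟦X⟧)) := by
  rw [PowerSeries.WithPiTopology.summable_iff_summable_coeff]
  intro d
  refine summable_of_ne_finset_zero (s := Finset.Icc (-(d : ℤ)) d) fun j hj => ?_
  have h := natAbs_le_thetaExponent hM hr hrM j
  rw [Finset.mem_Icc] at hj
  have h1 : ¬ thetaExponent M r j ≤ d := by omega
  rw [coeff_mul_X_pow', if_neg h1]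

theorem truncHom_theta {M r : ℕ} (hM : 3 ≤ M) (hr : 0 < r) (hrM : 2 * r ≤ M) {m : ℕ}
    (s : Finset ℤ) (hs : ∀ j : ℤ, j.natAbs < m → j ∈ s) :
    truncHom m (∑' j : ℤ, ((-1) ^ j.natAbs * X ^ thetaExponent M r j : ℚ⟦X⟧)) =
      ∑ j ∈ s, (-1) ^ j.natAbs * truncHom m X ^ thetaExponent M r j := by
  rw [truncHom_tsum (summable_theta hM hr hrM) s]
  · simp
  · intro j hj
    have h := natAbs_le_thetaExponent hM hr hrM j
    have h1 : ¬ j.natAbs < m := fun h => hj (hs j h)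
    rw [map_mul, map_pow _ X, truncHom_X_pow_of_le (by omega), mul_zero]

theorem sum_range_two_mul {S : Type*} [AddCommMonoid S] (t : ℕ → S) (n : ℕ) :
    ∑ k ∈ Finset.range (2 * n), t k = ∑ i ∈ Finset.range n, (t (2 * i) + t (2 * i + 1)) := by
  induction n with
  | zero => simp
  | succ n ih =>
    rw [show 2 * (n + 1) = 2 * n + 1 + 1 by ring, Finset.sum_range_succ, Finset.sum_range_succ,
      Finset.sum_range_succ, ih, add_assoc]

theorem colorGenFun_mul_eulerProduct {M r : ℕ} (hM : 3 ≤ M) (hr : 0 < r) (hrM : 2 * r ≤ M) :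
    colorGenFun M r * (∏' n : ℕ, (1 - X ^ (n + 1) : ℚ⟦X⟧)) =
      ∑' j : ℤ, ((-1) ^ j.natAbs * X ^ thetaExponent M r j : ℚ⟦X⟧) := by
  refine eq_of_truncHom_eq fun m => ?_
  -- Large enough that for `|i| ≤ m` the lower entries `N + M * i` and `N + r - M * (i + 1)` lie
  -- between `m` and `2 * N - m`, where the binomial inverts the Euler product modulo `X ^ m`.
  obtain ⟨N, hN⟩ : ∃ N, N = m + M * (m + 2) := ⟨_, rfl⟩
  have hNm : m ≤ N := by omega
  have h1 : truncHom m (colorGenFun M r) = truncHom m (frobeniusGenFun (RankBounded M r) N N) :=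
    truncHom_eq_iff.2 fun d hd => coeff_colorGenFun (by omega)
  rw [map_mul, h1, frobeniusGenFun_eq_rankSum hM hr hrM (N + N) N N le_rfl (by omega) (by omega),
    map_rankSum, truncHom_eulerProduct le_rfl]
  set x := truncHom m X with hx
  have hterm : ∀ (j k : ℤ), (j.natAbs < m → (m : ℤ) ≤ k ∧ k + m ≤ (N + N : ℕ)) →
      x ^ thetaExponent M r j * qBinom x (N + N) k * ∏ i ∈ Finset.range m, (1 - x ^ (i + 1)) =
        x ^ thetaExponent M r j := by
    intro j k hjk
    have h := natAbs_le_thetaExponent hM hr hrM j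
    rcases lt_or_ge j.natAbs m with hj | hj
    · rw [mul_assoc, qBinom_mul_prod_of_pow_eq_zero (truncHom_X_pow m) (hjk hj).1 (hjk hj).2 le_rfl,
        mul_one]
    · rw [hx, truncHom_X_pow_of_le (hj.trans h)]; simp
  have hNz : (N : ℤ) = m + M * (m + 2) := by exact_mod_cast hN
  have hE : ∀ i : ℤ, rankTermEven x M r N N i * ∏ i ∈ Finset.range m, (1 - x ^ (i + 1)) =
      x ^ thetaExponent M r (2 * i) := by
    intro i
    refine hterm _ _ fun hi => ?_
    have hi1 : i ≤ m := by omega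
    have hi2 : -(m : ℤ) ≤ i := by omega
    push_cast
    constructor <;> nlinarith
  have hO : ∀ i : ℤ, rankTermOdd x M r N N i * ∏ i ∈ Finset.range m, (1 - x ^ (i + 1)) =
      x ^ thetaExponent M r (2 * i + 1) := by
    intro i
    refine hterm _ _ fun hi => ?_
    have hi1 : i ≤ m := by omega
    have hi2 : -(m : ℤ) ≤ i := by omega
    have hi3 : 0 ≤ (M : ℤ) * (m - i) := mul_nonneg (by omega) (by omega)
    have hi4 : 0 ≤ (M : ℤ) * (m + i) := mul_nonneg (by omega) (by omega)
    push_cast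
    constructor <;> nlinarith
  have hinj : Function.Injective fun k : ℕ => (k : ℤ) - 2 * (N + N : ℕ) := by
    intro a b h
    simpa using h
  -- With `B = N + N`, the indices `-2B, ..., 2B + 1` split into the pairs `2i, 2i + 1` with `-B ≤ i
  -- ≤ B`, as in `rankSum`.
  rw [truncHom_theta hM hr hrM ((Finset.range (2 * (2 * (N + N) + 1))).map ⟨_, hinj⟩),
    Finset.sum_map, sum_range_two_mul, rankSum, Finset.sum_mul]
  · refine Finset.sum_congr rfl fun i _ => ?_
    rw [sub_mul, hE, hO]
    simp only [Function.Embedding.coeFn_mk]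
    rw [show ((2 * i : ℕ) : ℤ) - 2 * (N + N : ℕ) = 2 * (i - (N + N : ℕ)) by push_cast; ring,
      show ((2 * i + 1 : ℕ) : ℤ) - 2 * (N + N : ℕ) = 2 * (i - (N + N : ℕ)) + 1 by push_cast; ring,
      (show Even (2 * ((i : ℤ) - (N + N : ℕ))).natAbs by rw [Nat.even_iff]; omega).neg_one_pow,
      (show Odd (2 * ((i : ℤ) - (N + N : ℕ)) + 1).natAbs by rw [Nat.odd_iff]; omega).neg_one_pow]
    ring
  · intro j hj
    rw [Finset.mem_map]
    exact ⟨(j + 2 * (N + N : ℕ)).toNat, by rw [Finset.mem_range]; omega, by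
      simp only [Function.Embedding.coeFn_mk]; omega⟩

/-- The `q`-binomial theorem of length `2N` with base `X ^ K`, `a = X ^ (K * N - r)` and `b = -1`.
The lower half of the factors, reversed, yields the exponents `K * i + (K - r)`, the upper half `K *
i + r`; each factor sheds a monomial, and these are cancelled at the end. -/
theorem finite_jacobi_triple_product {K r N : ℕ} (hr : 2 * r ≤ K) (hN : 0 < N) :
    ∏ i ∈ Finset.range N, ((1 - X ^ (K * i + r)) * (1 - X ^ (K * i + (K - r))) : ℚ⟦X⟧) =
      ∑ k ∈ Finset.range (2 * N + 1), (-1) ^ ((N : ℤ) - k).natAbs *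
        X ^ thetaExponent K r ((N : ℤ) - k) * qBinom (X ^ K : ℚ⟦X⟧) (2 * N) k := by
  have hrN : r ≤ K * N := by nlinarith
  have hchoose : ∀ n : ℕ, ((n.choose 2 : ℕ) : ℤ) * 2 = n * (n - 1) := by
    intro n
    induction n with
    | zero => simp
    | succ n ih =>
      rw [Nat.choose_succ_succ n 1, Nat.choose_one_right]
      push_cast
      linarith
  have hgauss : ∀ n : ℕ, ∏ i ∈ Finset.range n, (-X ^ (K * i) : ℚ⟦X⟧) =
      (-1) ^ n * X ^ (K * n.choose 2) := by
    intro n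
    induction n with
    | zero => simp
    | succ n ih =>
      rw [Finset.prod_range_succ, ih, Nat.choose_succ_succ n 1, Nat.choose_one_right]
      ring
  have hC : ((-1) ^ N * X ^ (K * N.choose 2 + (K * N - r) * N) : ℚ⟦X⟧) ≠ 0 :=
    mul_ne_zero (pow_ne_zero _ (by simp)) (pow_ne_zero _ X_ne_zero)
  have h := prod_add_mul_pow_eq_sum (X ^ K : ℚ⟦X⟧) (X ^ (K * N - r)) (-1) (2 * N)
  have hL : ∏ i ∈ Finset.range (2 * N), ((X : ℚ⟦X⟧) ^ (K * N - r) + -1 * (X ^ K) ^ i) =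
      ((-1) ^ N * X ^ (K * N.choose 2 + (K * N - r) * N) : ℚ⟦X⟧) *
        ∏ i ∈ Finset.range N, ((1 - X ^ (K * i + r)) * (1 - X ^ (K * i + (K - r))) : ℚ⟦X⟧) := by
    rw [two_mul, Finset.prod_range_add,
      ← Finset.prod_range_reflect (fun i => (X : ℚ⟦X⟧) ^ (K * N - r) + -1 * (X ^ K) ^ i) N,
      Finset.prod_mul_distrib, pow_add, ← mul_assoc ((-1 : ℚ⟦X⟧) ^ N), ← hgauss N,
      ← Finset.prod_range_reflect (fun i => (-X ^ (K * i) : ℚ⟦X⟧)) N, pow_mul]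
    have e1 : ∏ i ∈ Finset.range N, ((X : ℚ⟦X⟧) ^ (K * N - r) + -1 * (X ^ K) ^ (N - 1 - i)) =
        ∏ i ∈ Finset.range N, (-X ^ (K * (N - 1 - i)) * (1 - X ^ (K * i + (K - r))) : ℚ⟦X⟧) := by
      refine Finset.prod_congr rfl fun i hi => ?_
      have hi' := Finset.mem_range.1 hi
      obtain ⟨d, rfl⟩ : ∃ d, N = i + 1 + d := ⟨N - (i + 1), by omega⟩
      rw [show i + 1 + d - 1 - i = d by omega,
        show K * (i + 1 + d) - r = K * d + (K * i + (K - r)) by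
          have : K * (i + 1 + d) = K * d + (K * i + K) := by ring
          omega]
      ring
    have e2 : ∏ i ∈ Finset.range N, ((X : ℚ⟦X⟧) ^ (K * N - r) + -1 * (X ^ K) ^ (N + i)) =
        (X ^ (K * N - r)) ^ N * ∏ i ∈ Finset.range N, (1 - X ^ (K * i + r) : ℚ⟦X⟧) := by
      rw [show ((X : ℚ⟦X⟧) ^ (K * N - r)) ^ N = ∏ _i ∈ Finset.range N, X ^ (K * N - r) by simp,
        ← Finset.prod_mul_distrib]
      refine Finset.prod_congr rfl fun i _ => ?_
      rw [mul_sub, ← pow_add, show K * N - r + (K * i + r) = K * (N + i) by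
        rw [mul_add]; omega]
      ring
    rw [e1, e2, Finset.prod_mul_distrib]
    ring
  rw [hL] at h
  refine mul_left_cancel₀ hC ?_
  rw [h, Finset.mul_sum]
  refine Finset.sum_congr rfl fun k hk => ?_
  have hk' : k ≤ 2 * N := by have := Finset.mem_range.1 hk; omega
  have hsign : ((-1) ^ k : ℚ⟦X⟧) = (-1) ^ N * (-1) ^ ((N : ℤ) - k).natAbs := by
    rw [← pow_add]
    refine neg_one_pow_congr ?_
    rw [Nat.even_iff, Nat.even_iff]
    omega
  have hexp : K * k.choose 2 + (K * N - r) * (2 * N - k) =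
      K * N.choose 2 + (K * N - r) * N + thetaExponent K r ((N : ℤ) - k) := by
    have h1 := two_mul_thetaExponent K r hr ((N : ℤ) - k)
    have h2 := hchoose k
    have h3 := hchoose N
    zify [hrN, hk']
    refine mul_left_cancel₀ (two_ne_zero : (2 : ℤ) ≠ 0) ?_
    linear_combination (K : ℤ) * h2 - (K : ℤ) * h3 - h1
  have hX : ((X ^ K) ^ k.choose 2 * (X ^ (K * N - r)) ^ (2 * N - k) : ℚ⟦X⟧) =
      X ^ (K * N.choose 2 + (K * N - r) * N) * X ^ thetaExponent K r ((N : ℤ) - k) := by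
    rw [← pow_mul, ← pow_mul, ← pow_add, ← pow_add, hexp]
  rw [hsign]
  linear_combination (-1) ^ N * (-1) ^ ((N : ℤ) - k).natAbs *
    qBinom (X ^ K : ℚ⟦X⟧) (2 * N) k * hX

end ThetaSeries

/-! ### The infinite product over the allowed residues. -/

section ProductSide

theorem truncHom_theta_eq_prod {M r : ℕ} (hM : 3 ≤ M) (hr : 0 < r) (hrM : 2 * r ≤ M) {m N : ℕ}
    (hm : 0 < m) (hN : 2 * m ≤ N) :
    truncHom m (∑' j : ℤ, ((-1) ^ j.natAbs * X ^ thetaExponent M r j : ℚ⟦X⟧)) =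
      ∏ i ∈ Finset.range N, ((1 - truncHom m X ^ (M * i + r)) *
        (1 - truncHom m X ^ (M * i + (M - r))) * (1 - truncHom m X ^ (M * i + M))) := by
  have hinj : Function.Injective fun k : ℕ => (N : ℤ) - k := by
    intro a b h
    simpa using h
  have hJ := congrArg (truncHom m) (finite_jacobi_triple_product (N := N) hrM (by omega))
  rw [Finset.prod_mul_distrib]
  simp only [map_sum, map_prod, map_mul, map_sub, map_one, map_pow, map_neg, map_qBinom] at hJ
  rw [hJ, truncHom_theta hM hr hrM ((Finset.range (2 * N + 1)).map ⟨_, hinj⟩), Finset.sum_map,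
    Finset.sum_mul]
  · refine Finset.sum_congr rfl fun k hk => ?_
    simp only [Function.Embedding.coeFn_mk]
    have h := natAbs_le_thetaExponent hM hr hrM (N - k)
    rcases lt_or_ge ((N : ℤ) - k).natAbs m with hj | hj
    · have hq : (truncHom m X ^ M) ^ m = 0 := by
        rw [← pow_mul]
        exact truncHom_X_pow_of_le (by nlinarith)
      -- For `|N - k| < m` the binomial in base `X ^ M` is cancelled by the factors `1 - X ^ (M * i
      -- + M)`; the other terms vanish modulo `X ^ m`.
      have h1 := qBinom_mul_prod_of_pow_eq_zero hq (n := 2 * N) (k := k) (T := N) (by omega)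
        (by push_cast; omega) (by omega)
      simp only [← pow_mul, mul_add, mul_one] at h1 ⊢
      rw [mul_assoc, h1, mul_one]
    · rw [truncHom_X_pow_of_le (hj.trans h)]; simp
  · intro j hj
    rw [Finset.mem_map]
    exact ⟨(N - j).toNat, by rw [Finset.mem_range]; omega, by
      simp only [Function.Embedding.coeFn_mk]; omega⟩

theorem mul_add_succ_mem_allowedParts_iff {M r l s : ℕ} (hr : 0 < r) (hrM : 2 * r < M)
    (hs : s < M) : M * l + s + 1 ∈ allowedParts M r ↔ s + 1 ≠ M ∧ s + 1 ≠ r ∧ s + 1 ≠ M - r := by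
  have key : ∀ a : ℤ, ((M * l + s + 1 : ℕ) : ℤ) ≡ a [ZMOD M] ↔ (M : ℤ) ∣ s + 1 - a := by
    intro a
    rw [Int.modEq_comm, Int.modEq_iff_dvd]
    push_cast
    rw [show (M : ℤ) * l + s + 1 - a = M * l + (s + 1 - a) by ring]
    exact (Int.dvd_add_right (dvd_mul_right _ _))
  have hdvd : ∀ a : ℤ, -M < a → a < M → ((M : ℤ) ∣ a ↔ a = 0) := by
    intro a h1 h2
    refine ⟨fun h => Int.eq_zero_of_abs_lt_dvd h (abs_lt.2 ⟨h1, h2⟩), ?_⟩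
    rintro rfl
    exact dvd_zero _
  -- Here and in `h2`, subtracting `M` moves the number into `(-M, M)`, where `0` is the only
  -- multiple of `M`.
  have h0 : (M : ℤ) ∣ s + 1 - 0 ↔ s + 1 = M := by
    rw [show (s : ℤ) + 1 - 0 = (s + 1 - M) + M by ring, Int.dvd_add_left (dvd_refl _),
      hdvd _ (by omega) (by omega)]
    omega
  have h1 : (M : ℤ) ∣ s + 1 - r ↔ s + 1 = r := by
    rw [hdvd _ (by omega) (by omega)]
    omega
  have h2 : (M : ℤ) ∣ s + 1 - -r ↔ s + 1 = M - r := by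
    rw [show (s : ℤ) + 1 - -r = (s + 1 + r - M) + M by ring, Int.dvd_add_left (dvd_refl _),
      hdvd _ (by omega) (by omega)]
    omega
  simp only [allowedParts, Set.mem_ofPred_eq, key, h0, h1, h2]
  simp

theorem prod_range_mul_eq {S : Type*} [CommMonoid S] (f : ℕ → S) (K N : ℕ) :
    ∏ n ∈ Finset.range (K * N), f n =
      ∏ l ∈ Finset.range N, ∏ s ∈ Finset.range K, f (K * l + s) := by
  induction N with
  | zero => simp
  | succ N ih => rw [mul_add, mul_one, Finset.prod_range_add, ih, Finset.prod_range_succ]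

open Classical in
theorem prod_not_allowedParts {S : Type*} [CommMonoid S] (g : ℕ → S) {M r : ℕ} (hr : 0 < r)
    (hrM : 2 * r < M) (N : ℕ) :
    ∏ n ∈ Finset.range (M * N), (if n + 1 ∈ allowedParts M r then 1 else g (n + 1)) =
      ∏ l ∈ Finset.range N, (g (M * l + r) * g (M * l + (M - r)) * g (M * l + M)) := by
  rw [prod_range_mul_eq]
  refine Finset.prod_congr rfl fun l _ => ?_
  -- These three indices are distinct because `2 * r < M`; for `2 * r = M` the first two would
  -- coincide.
  have hsub : ({r - 1, M - r - 1, M - 1} : Finset ℕ) ⊆ Finset.range M := by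
    intro s hs
    simp only [Finset.mem_insert, Finset.mem_singleton] at hs
    rw [Finset.mem_range]
    omega
  have hval : ∀ s < M, s + 1 = M ∨ s + 1 = r ∨ s + 1 = M - r →
      (if M * l + s + 1 ∈ allowedParts M r then 1 else g (M * l + s + 1)) =
        g (M * l + (s + 1)) := by
    intro s hs h
    rw [if_neg, add_assoc]
    rw [mul_add_succ_mem_allowedParts_iff hr hrM hs]
    omega
  rw [← Finset.prod_subset hsub, Finset.prod_insert, Finset.prod_insert, Finset.prod_singleton,
    hval _ (by omega) (by omega), hval _ (by omega) (by omega), hval _ (by omega) (by omega),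
    Nat.sub_add_cancel (by omega), Nat.sub_add_cancel (by omega), Nat.sub_add_cancel (by omega),
    mul_assoc]
  · simp only [Finset.mem_singleton]; omega
  · simp only [Finset.mem_insert, Finset.mem_singleton]; omega
  · intro s hs hs'
    simp only [Finset.mem_insert, Finset.mem_singleton] at hs'
    have hs := Finset.mem_range.1 hs
    rw [if_pos]
    rw [mul_add_succ_mem_allowedParts_iff hr hrM hs]
    omega

theorem one_sub_X_pow_mul_inv {n : ℕ} (hn : 0 < n) :
    (1 - X ^ n : ℚ⟦X⟧) * (1 - X ^ n : ℚ⟦X⟧)⁻¹ = 1 :=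
  PowerSeries.mul_inv_cancel _ (by simp [hn.ne'])

/-- Each factor is `1` plus a series of order at least `n`. -/
theorem multipliable_mulIndicator_inv_one_sub_X_pow {A : Set ℕ} (hA : ∀ n ∈ A, 0 < n) :
    Multipliable (A.mulIndicator fun n : ℕ => (1 - X ^ n : ℚ⟦X⟧)⁻¹) := by
  classical
  have h : (A.mulIndicator fun n : ℕ => (1 - X ^ n : ℚ⟦X⟧)⁻¹) =
      fun n => 1 + A.indicator (fun n : ℕ => X ^ n * (1 - X ^ n : ℚ⟦X⟧)⁻¹) n := by
    funext n
    by_cases hn : n ∈ A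
    · rw [Set.mulIndicator_of_mem hn, Set.indicator_of_mem hn]
      linear_combination one_sub_X_pow_mul_inv (hA n hn)
    · rw [Set.mulIndicator_of_notMem hn, Set.indicator_of_notMem hn, add_zero]
  rw [h]
  refine PowerSeries.WithPiTopology.multipliable_one_add_of_tendsto_order_atTop_nhds_top ℚ ?_
  refine tendsto_nhds_top_mono ENat.tendsto_natCast_nhds_top (Filter.Eventually.of_forall fun n => ?_)
  dsimp only
  by_cases hn : n ∈ A
  · rw [Set.indicator_of_mem hn]
    exact le_order _ _ fun i hi => by
      rw [coeff_X_pow_mul', if_neg (by exact_mod_cast not_le.2 hi)]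
  · rw [Set.indicator_of_notMem hn]
    simp

/-- The Euler product cancels the allowed factors and leaves those with `n ≡ 0, ±r`, which form the
triple product. -/
theorem tprod_allowedParts_mul_eulerProduct {M r : ℕ} (hM : 3 ≤ M) (hr : 0 < r)
    (hrM : 2 * r < M) :
    (∏' n : allowedParts M r, (1 - X ^ (n : ℕ) : ℚ⟦X⟧)⁻¹) *
        (∏' n : ℕ, (1 - X ^ (n + 1) : ℚ⟦X⟧)) =
      ∑' j : ℤ, ((-1) ^ j.natAbs * X ^ thetaExponent M r j : ℚ⟦X⟧) := by
  classical
  have hmul := multipliable_mulIndicator_inv_one_sub_X_pow (A := allowedParts M r)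
    fun n hn => hn.1
  rw [tprod_subtype (allowedParts M r) fun n : ℕ => (1 - X ^ n : ℚ⟦X⟧)⁻¹]
  refine eq_of_truncHom_eq fun m => ?_
  rcases Nat.eq_zero_or_pos m with rfl | hm
  · exact truncHom_eq_iff.2 fun d hd => absurd hd (Nat.not_lt_zero d)
  have hT : m ≤ M * (2 * m) := by nlinarith
  have hinv : ∀ n ∈ allowedParts M r,
      (1 - truncHom m X ^ n) * truncHom m (1 - X ^ n : ℚ⟦X⟧)⁻¹ = 1 := by
    intro n hn
    have h := congrArg (truncHom m) (one_sub_X_pow_mul_inv hn.1)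
    simpa using h
  -- The extra index `0` contributes the factor `1`; splitting it off aligns the product with the
  -- shifted Euler product.
  rw [map_mul, truncHom_eulerProduct hT, truncHom_theta_eq_prod hM hr hrM.le hm le_rfl,
    truncHom_tprod hmul (Finset.range (M * (2 * m) + 1)), Finset.prod_range_succ',
    Set.mulIndicator_of_notMem (a := 0) fun h => lt_irrefl 0 h.1, map_one, mul_one,
    ← Finset.prod_mul_distrib,
    ← prod_not_allowedParts (fun n => 1 - truncHom m X ^ n) hr hrM (2 * m)]
  · refine Finset.prod_congr rfl fun n _ => ?_
    split_ifs with hn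
    · rw [Set.mulIndicator_of_mem hn, mul_comm, hinv _ hn]
    · rw [Set.mulIndicator_of_notMem hn, map_one, one_mul]
  · intro n hn
    rw [Finset.mem_range, not_lt] at hn
    by_cases h : n ∈ allowedParts M r
    · rw [Set.mulIndicator_of_mem h]
      have h1 := hinv n h
      rwa [truncHom_X_pow_of_le (by omega), sub_zero, one_mul] at h1
    · rw [Set.mulIndicator_of_notMem h, map_one]

end ProductSide

/-- Needed for `⁻¹` of the Euler product to be a true inverse; modulo `X` the product is `1`. -/
theorem constantCoeff_eulerProduct_ne_zero :
    constantCoeff (∏' n : ℕ, (1 - X ^ (n + 1) : ℚ⟦X⟧)) ≠ 0 := by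
  have h := truncHom_eulerProduct (m := 1) (T := 1) le_rfl
  rw [Finset.prod_range_one, truncHom_X_pow_of_le le_rfl, sub_zero, ← map_one (truncHom 1),
    truncHom_eq_iff] at h
  rw [← coeff_zero_eq_constantCoeff_apply, h 0 one_pos]
  simp

theorem mainTheorem2 (M r : ℕ) (hM : 3 ≤ M) (hr : 0 < r) (hrM : 2 * r ≤ M) :
    (Multipliable (fun n : ℕ => (1 - X ^ (n + 1) : ℚ⟦X⟧)) ∧
      Summable (fun j : ℤ => ((-1) ^ j.natAbs * X ^ thetaExponent M r j : ℚ⟦X⟧)) ∧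
      colorGenFun M r =
        (∏' n : ℕ, (1 - X ^ (n + 1) : ℚ⟦X⟧))⁻¹ *
          ∑' j : ℤ, ((-1) ^ j.natAbs * X ^ thetaExponent M r j : ℚ⟦X⟧)) ∧
    (2 * r < M →
      Multipliable (fun n : allowedParts M r => (1 - X ^ (n : ℕ) : ℚ⟦X⟧)⁻¹) ∧
      (∏' n : ℕ, (1 - X ^ (n + 1) : ℚ⟦X⟧))⁻¹ *
          ∑' j : ℤ, ((-1) ^ j.natAbs * X ^ thetaExponent M r j : ℚ⟦X⟧) =
        ∏' n : allowedParts M r, (1 - X ^ (n : ℕ) : ℚ⟦X⟧)⁻¹) := by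
  have hP := PowerSeries.mul_inv_cancel _ constantCoeff_eulerProduct_ne_zero
  refine ⟨⟨PowerSeries.WithPiTopology.multipliable_one_sub_X_pow ℚ, summable_theta hM hr hrM, ?_⟩,
    fun hlt => ⟨?_, ?_⟩⟩
  · rw [← colorGenFun_mul_eulerProduct hM hr hrM, mul_left_comm, mul_comm _⁻¹, hP, mul_one]
  · exact multipliable_subtype_iff_mulIndicator.2
      (multipliable_mulIndicator_inv_one_sub_X_pow fun n hn => hn.1)
  · rw [← tprod_allowedParts_mul_eulerProduct hM hr hlt, mul_left_comm, mul_comm _⁻¹, hP, mul_one]
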